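/- A permutation $\sigma\in S_m$ (written as a word $\sigma_1\sigma_2\cdots\sigma_m$) is a \emph{wedge pattern} if it can be written as a concatenation $\sigma=(\tau^1,\rho^1,\dots,\tau^r,\rho^r)$ such that each $\tau^i$ is nonempty, $(\tau^1,\tau^2,\dots,\tau^r)=(s+1,s+2,\dots,m)$ for some $0\le s\le m$, and $\rho^1,\dots,\rho^r$ are the layers of a layered permutation of $1,\dots,s$, i.e. there are integers $s=m_0\ge m_1\ge\dots\ge m_r=0$ with $\rho^i=(m_i+1,m_i+2,\dots,m_{i-1})$ for all $i$ (the empty permutation, with $r=0$, is allowed). For a set $T$ of patterns, $S_n(T)$ is the set of permutations of $\{1,\dots,n\}$ avoiding every pattern in $T$. For $k\ge1$ let $$R_k(x)=\frac{2t\,U_{k-1}(t)}{U_k(t)},\qquad t=\frac1{2\sqrt x},$$ where $U_r$ is the Chebyshev polynomial of the second kind, $U_r(\cos\theta)=\sin((r+1)\theta)/\sin\theta$. For a word $w$, let $w+l$ be the word obtained by adding $l$ to each letter. \textbf{Theorem.} Let $l\ge1$, let $\sigma\in S_{l-1}$ be a wedge pattern, and let $k\ge 2l$. If $\tau\in S_k$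 is any one of the three patterns $$(\sigma^{-1}+l,\,2l,\,\sigma,\,l,\,2l+1,\dots,k),\quad (\sigma+l,\,2l,\,\sigma^{-1},\,l,\,2l+1,\dots,k),\quad (\sigma+l,\,2l,\,\sigma,\,l,\,2l+1,\dots,k),$$ then $$\sum_{n\ge0}|S_n(132,\tau)|\,x^n=R_k(x).$$ -/

import Mathlib

namespace WedgePattern

/-- The one-line notation `(σ 1, σ 2, …, σ n)` of a permutation of `[n]`, with values in
`{1, …, n}` (`Fin n` is `{0, …, n - 1}`, hence the shift). -/
def oneLine {n : ℕ} (σ : Equiv.Perm (Fin n)) : List ℕ :=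
  List.ofFn fun i => (σ i : ℕ) + 1

/-- `Contains α w`: some subsequence `α (f 1), …, α (f k)` with `f 1 < ⋯ < f k` is
order-isomorphic to the pattern `w`, written in one-line notation. -/
def Contains {n : ℕ} (α : Equiv.Perm (Fin n)) (w : List ℕ) : Prop :=
  ∃ f : Fin w.length ↪o Fin n, ∀ i j, α (f i) < α (f j) ↔ w.get i < w.get j

/-- The set `S_n(132, w)` of permutations of `[n]` that avoid both `132` and `w`. -/
def avoiders (n : ℕ) (w : List ℕ) : Set (Equiv.Perm (Fin n)) :=
  {α | ¬ Contains α [1, 3, 2] ∧ ¬ Contains α w}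

/-- The generating function `∑ |S_n(132, w)| x ^ n`. -/
noncomputable def genFun (w : List ℕ) : PowerSeries ℚ :=
  PowerSeries.mk fun n => ((avoiders n w).ncard : ℚ)

/-- `ρ` is the sequence of layers of a layered permutation of `1, …, s`:
there are `s = m 0 ≥ m 1 ≥ ⋯ ≥ m r = 0` such that the `i`-th layer is the increasing word
`m (i + 1) + 1, m (i + 1) + 2, …, m i`. Empty layers do no harm. -/
def IsLayers {r : ℕ} (s : ℕ) (ρ : Fin r → List ℕ) : Prop :=
  ∃ m : ℕ → ℕ, Antitone m ∧ m 0 = s ∧ m r = 0 ∧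
    ∀ i : Fin r, ρ i = List.range' (m (i + 1) + 1) (m i - m (i + 1))

/-- `σ = (τ 1, ρ 1, …, τ r, ρ r)` where each `τ i` is nonempty, `ρ 1, …, ρ r` are the layers of
a layered permutation of `1, …, s`, and `(τ 1, …, τ r) = (s + 1, s + 2, …, n)`. -/
def IsWedge {n : ℕ} (σ : Equiv.Perm (Fin n)) : Prop :=
  ∃ (r s : ℕ) (τ ρ : Fin r → List ℕ),
    (∀ i, τ i ≠ []) ∧
    IsLayers s ρ ∧
    (List.ofFn τ).flatten = List.range' (s + 1) (n - s) ∧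
    oneLine σ = (List.ofFn fun i => τ i ++ ρ i).flatten

/-- The pattern `(u + l, 2l, v, l, 2l + 1, 2l + 2, …, k)`, in one-line notation. -/
def extPattern (l k : ℕ) (u v : Equiv.Perm (Fin (l - 1))) : List ℕ :=
  (oneLine u).map (· + l) ++ [2 * l] ++ oneLine v ++ [l] ++ List.range' (2 * l + 1) (k - 2 * l)

/-- `R_k(x) = 2 t U_{k-1}(t) / U_k(t)` with `t = 1 / (2 √x)`, as a function of `y = √x`;
here `U` are the Chebyshev polynomials of the second kind. -/
noncomputable def chebR {K : Type*} [Field K] (k : ℕ) (y : K) : K :=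
  2 * (1 / (2 * y)) * (Polynomial.Chebyshev.U K ((k : ℤ) - 1)).eval (1 / (2 * y)) /
    (Polynomial.Chebyshev.U K (k : ℤ)).eval (1 / (2 * y))

/-- `F(x) = R_k(x)`. The identity is read in the field `ℚ((y))` of formal Laurent series
in `y = √x`: it says `F(y ^ 2) = 2 t U_{k-1}(t) / U_k(t)` with `t = 1 / (2 y)`. -/
def EqualsR (F : PowerSeries ℚ) (k : ℕ) : Prop :=
  ((PowerSeries.expand 2 two_ne_zero F : PowerSeries ℚ) : LaurentSeries ℚ) =
    chebR k ((PowerSeries.X : PowerSeries ℚ) : LaurentSeries ℚ)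

end WedgePattern

namespace WedgePattern

/-! In a nonempty `132`-avoider every letter left of the maximum exceeds every letter right of it,
so the permutation is a pair of smaller `132`-avoiders, and `132`-avoiders are binary trees.

Take a pattern `(w, M, z)` with `M` its maximum, all letters of `w` above those of `z`, and `z`
empty or ending in its own maximum. An occurrence in a permutation split at its maximum lies inside
one side, or else the left side contains `w` and the right side contains `z`
(`occurs_append_cons_iff`). With generating functions `A`, `B`, `F` for `w`, `z`, `(w, M, z)` this
gives `F = 1 + x (A F + F B - A B)` (`genFun_append_cons`). If `A = R_a` and `B = R_b`, the addition
formula for Chebyshev polynomials yields `F = R_{a+b+1}` (`HasChebGenFun.append_cons`).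

So having generating function `R_length` survives this operation. A wedge pattern is built from the
empty word by repeating it (`IsWedge.hasChebGenFun`), inversion preserves the property because `132`
is an involution, and one more application followed by appending new maxima gives the three
patterns. -/

/-! ### Occurrences of patterns in words -/

/-- `Occurs L w`: some subsequence of the word `L` is the image of the word `w` under a map that
is strictly increasing on the letters of `w`. -/
def Occurs (L w : List ℕ) : Prop :=
  ∃ g : ℕ → ℕ, StrictMonoOn g {x | x ∈ w} ∧ (w.map g).Sublist L

theorem Occurs.mono {L L' w : List ℕ} (h : Occurs L w) (hL : L.Sublist L') : Occurs L' w :=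
  let ⟨g, hg, hs⟩ := h
  ⟨g, hg, hs.trans hL⟩

theorem Occurs.of_sublist {L w w' : List ℕ} (h : Occurs L w) (hw : w'.Sublist w) : Occurs L w' :=
  let ⟨g, hg, hs⟩ := h
  ⟨g, hg.mono fun _ hx => hw.subset hx, (hw.map g).trans hs⟩

theorem occurs_nil (L : List ℕ) : Occurs L [] := ⟨id, by simp [StrictMonoOn], by simp⟩

theorem not_occurs_nil {w : List ℕ} (hw : w ≠ []) : ¬ Occurs [] w := by
  rintro ⟨g, -, hs⟩
  simp_all

theorem occurs_map_left_iff {h : ℕ → ℕ} (hh : StrictMono h) (L w : List ℕ) :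
    Occurs (L.map h) w ↔ Occurs L w := by
  constructor
  · rintro ⟨g, hg, hs⟩
    obtain ⟨l, hl, e⟩ := List.sublist_map_iff.1 hs
    have key : ∀ x ∈ w, h (Function.invFun h (g x)) = g x := by
      intro x hx
      have : g x ∈ w.map g := List.mem_map_of_mem hx
      rw [e, List.mem_map] at this
      obtain ⟨y, -, hy⟩ := this
      exact Function.invFun_eq ⟨y, hy⟩
    refine ⟨fun x => Function.invFun h (g x), ?_, ?_⟩
    · intro x hx y hy hxy
      rw [← hh.lt_iff_lt, key x hx, key y hy]
      exact hg hx hy hxy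
    · convert hl
      apply (List.map_injective_iff.2 hh.injective)
      rw [← e, List.map_map]
      exact List.map_congr_left key
  · rintro ⟨g, hg, hs⟩
    exact ⟨h ∘ g, hh.comp_strictMonoOn hg, by simpa using hs.map h⟩

theorem occurs_map_right_iff {h : ℕ → ℕ} (hh : StrictMono h) (L w : List ℕ) :
    Occurs L (w.map h) ↔ Occurs L w := by
  constructor
  · rintro ⟨g, hg, hs⟩
    refine ⟨g ∘ h, fun x hx y hy hxy => hg ?_ ?_ (hh hxy), by simpa using hs⟩
    · exact List.mem_map_of_mem hx
    · exact List.mem_map_of_mem hy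
  · rintro ⟨g, hg, hs⟩
    have key : ∀ x, Function.invFun h (h x) = x := Function.leftInverse_invFun hh.injective
    refine ⟨g ∘ Function.invFun h, ?_, ?_⟩
    · intro x hx y hy hxy
      obtain ⟨a, ha, rfl⟩ := List.mem_map.1 hx
      obtain ⟨b, hb, rfl⟩ := List.mem_map.1 hy
      simp only [Function.comp, key]
      exact hg ha hb (hh.lt_iff_lt.1 hxy)
    · convert hs using 1
      simp [key]

theorem occurs_append_cons {L₁ L₂ : List ℕ} {N : ℕ} (h12 : ∀ x ∈ L₁, ∀ y ∈ L₂, y < x)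
    (hN₁ : ∀ x ∈ L₁, x < N) (hN₂ : ∀ y ∈ L₂, y < N) {w z : List ℕ} {M : ℕ}
    (hwz : ∀ x ∈ w, ∀ y ∈ z, y < x) (hwM : ∀ x ∈ w, x < M) (hzM : ∀ y ∈ z, y < M)
    (hw : Occurs L₁ w) (hz : Occurs L₂ z) : Occurs (L₁ ++ N :: L₂) (w ++ M :: z) := by
  obtain ⟨g₁, hg₁, hs₁⟩ := hw
  obtain ⟨g₂, hg₂, hs₂⟩ := hz
  -- The letters of `w`, the letter `M` and the letters of `z` are distinct by the order hypotheses,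
  -- so the two embeddings glue.
  set g : ℕ → ℕ := fun x => if x ∈ w then g₁ x else if x = M then N else g₂ x with hg
  have e₁ : ∀ x ∈ w, g x = g₁ x := fun x hx => by simp [hg, hx]
  have eM : g M = N := by
    have : M ∉ w := fun h => (hwM M h).false
    simp [hg, this]
  have e₂ : ∀ x ∈ z, g x = g₂ x := fun x hx => by
    have h1 : x ∉ w := fun h => (hwz x h x hx).false
    have h2 : x ≠ M := (hzM x hx).ne
    simp [hg, h1, h2]
  have m₁ : ∀ x ∈ w, g₁ x ∈ L₁ := fun x hx => hs₁.subset (List.mem_map_of_mem hx)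
  have m₂ : ∀ x ∈ z, g₂ x ∈ L₂ := fun x hx => hs₂.subset (List.mem_map_of_mem hx)
  refine ⟨g, ?_, ?_⟩
  · intro x hx y hy hxy
    simp only [Set.mem_ofPred_eq, List.mem_append, List.mem_cons] at hx hy
    rcases hx with hx | rfl | hx <;> rcases hy with hy | rfl | hy
    · rw [e₁ x hx, e₁ y hy]; exact hg₁ hx hy hxy
    · rw [e₁ x hx, eM]; exact hN₁ _ (m₁ x hx)
    · exact absurd hxy (hwz x hx y hy).not_gt
    · exact absurd hxy (hwM y hy).not_gt
    · exact absurd hxy (lt_irrefl _)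
    · exact absurd hxy (hzM y hy).not_gt
    · rw [e₂ x hx, e₁ y hy]; exact h12 _ (m₁ y hy) _ (m₂ x hx)
    · rw [e₂ x hx, eM]; exact hN₂ _ (m₂ x hx)
    · rw [e₂ x hx, e₂ y hy]; exact hg₂ hx hy hxy
  · rw [List.map_append, List.map_cons, List.map_congr_left e₁, List.map_congr_left e₂, eM]
    exact hs₁.append (hs₂.cons_cons N)

/-- The cases are the possible places of the image of `M`. In `L₂`: a letter of `w` in `L₁` would
lie above it, so all of the occurrence is in `L₂`. At `N`: `w` falls in `L₁` and `z` in `L₂`. In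
`L₁`: either nothing falls in `L₂`, or the last letter of `z` does; being the maximum of `z`, it
drags all of `z` along. -/
theorem occurs_append_cons_iff {L₁ L₂ : List ℕ} {N : ℕ} (h12 : ∀ x ∈ L₁, ∀ y ∈ L₂, y < x)
    (hN₁ : ∀ x ∈ L₁, x < N) (hN₂ : ∀ y ∈ L₂, y < N) {w z : List ℕ} {M : ℕ}
    (hwz : ∀ x ∈ w, ∀ y ∈ z, y < x) (hwM : ∀ x ∈ w, x < M) (hzM : ∀ y ∈ z, y < M)
    (hz : z = [] ∨ ∃ z' c, z = z' ++ [c] ∧ ∀ x ∈ z', x < c) :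
    Occurs (L₁ ++ N :: L₂) (w ++ M :: z) ↔
      Occurs L₂ (w ++ M :: z) ∨ Occurs L₁ (w ++ M :: z) ∨ (Occurs L₁ w ∧ Occurs L₂ z) := by
  constructor
  · rintro ⟨g, hg, hs⟩
    have gw : StrictMonoOn g {x | x ∈ w} := hg.mono fun x hx => by simp_all
    have gz : StrictMonoOn g {x | x ∈ z} := hg.mono fun x hx => by simp_all
    have gwM : ∀ x ∈ w, g x < g M := fun x hx => hg (by simp [hx]) (by simp) (hwM x hx)
    have gzM : ∀ x ∈ z, g x < g M := fun x hx => hg (by simp [hx]) (by simp) (hzM x hx)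
    obtain ⟨p', s', e', hp, hs'⟩ := List.sublist_append_iff.1 hs
    obtain ⟨p, s, e, rfl, rfl⟩ := List.map_eq_append_iff.1 e'
    clear e' hs
    have hp' : ∀ x ∈ p, g x ∈ L₁ := fun x hx => hp.subset (List.mem_map_of_mem hx)
    have left : ∀ c, w = p ++ c → s = c ++ M :: z →
        Occurs L₂ (w ++ M :: z) ∨ Occurs L₁ (w ++ M :: z) ∨ (Occurs L₁ w ∧ Occurs L₂ z) := by
      rintro c rfl rfl
      rcases List.sublist_cons_iff.1 hs' with hs | ⟨r, hr, hs⟩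
      · have : p = [] := by
          refine List.eq_nil_iff_forall_not_mem.2 fun x hx => ?_
          have h1 := h12 _ (hp' x hx) (g M) (hs.subset (by simp))
          exact (gwM x (by simp [hx])).not_gt h1
        subst this
        exact Or.inl ⟨g, hg, hs⟩
      · cases c with
        | nil =>
          simp only [List.nil_append, List.map_cons, List.cons.injEq] at hr
          refine Or.inr (Or.inr ⟨⟨g, gw, by simpa using hp⟩, ⟨g, gz, ?_⟩⟩)
          rw [hr.2]
          exact hs
        | cons x c =>
          simp only [List.cons_append, List.map_cons, List.cons.injEq] at hr
          have h1 := hN₂ (g M) (hs.subset (by rw [← hr.2]; simp))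
          have h2 := gwM x (by simp)
          omega
    rcases List.append_eq_append_iff.1 e with ⟨a, rfl, ha⟩ | ⟨c, h1, h2⟩
    · cases a with
      | nil => exact left [] (by simp) (by simpa using ha.symm)
      | cons b a =>
        simp only [List.cons_append, List.cons.injEq] at ha
        obtain ⟨rfl, rfl⟩ := ha
        have hM := hp' M (by simp)
        have hs2 : (s.map g).Sublist L₂ := by
          rcases List.sublist_cons_iff.1 hs' with hs | ⟨r, hr, hs⟩
          · exact hs
          · have : N ∈ s.map g := by simp [hr]
            obtain ⟨y, hy, rfl⟩ := List.mem_map.1 this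
            exact absurd (gzM y (by simp [hy])) (hN₁ _ hM).not_gt
        rcases List.eq_nil_or_concat s with rfl | ⟨s, c, rfl⟩
        · exact Or.inr (Or.inl ⟨g, hg, by simpa using hp⟩)
        · have : a = [] := by
            refine List.eq_nil_iff_forall_not_mem.2 fun x hx => ?_
            rcases hz with hz | ⟨z', c', hz, hc⟩
            · simp at hz
            · rw [List.concat_eq_append, ← List.append_assoc] at hz
              obtain ⟨h1, h2⟩ := List.append_inj' hz rfl
              simp only [List.cons.injEq, and_true] at h2
              subst h1 h2
              have h3 := gz (a := x) (b := c) (by simp [hx]) (by simp) (hc x (by simp [hx]))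
              exact h3.not_gt (h12 _ (hp' x (by simp [hx])) _ (hs2.subset (by simp)))
          subst this
          refine Or.inr (Or.inr ⟨⟨g, gw, ?_⟩, ⟨g, gz, by simpa using hs2⟩⟩)
          exact ((List.sublist_append_left _ _).map g).trans hp
    · exact left c h1 h2
  · rintro (h | h | ⟨h1, h2⟩)
    · exact h.mono ((List.sublist_cons_self _ _).trans (List.sublist_append_right _ _))
    · exact h.mono (List.sublist_append_left _ _)
    · exact occurs_append_cons h12 hN₁ hN₂ hwz hwM hzM h1 h2

theorem contains_iff_occurs {n : ℕ} (α : Equiv.Perm (Fin n)) (w : List ℕ) :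
    Contains α w ↔ Occurs (oneLine α) w := by
  constructor
  · rintro ⟨f, hf⟩
    -- This makes the letter map `g` below independent of the chosen position, as `w` is an
    -- arbitrary word that might repeat letters.
    have hinj : ∀ i j, w.get i = w.get j → α (f i) = α (f j) := by
      intro i j h
      apply le_antisymm
      · rw [← not_lt, hf, h]; exact lt_irrefl _
      · rw [← not_lt, hf, h]; exact lt_irrefl _
    let g : ℕ → ℕ := fun x => if h : x ∈ w then (α (f (Classical.choose (List.get_of_mem h))) : ℕ) + 1
      else 0
    have hg : ∀ i, g (w.get i) = (α (f i) : ℕ) + 1 := by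
      intro i
      have h : w.get i ∈ w := List.get_mem _ _
      simp only [g, dif_pos h]
      rw [hinj _ i (Classical.choose_spec (List.get_of_mem h))]
    refine ⟨g, ?_, ?_⟩
    · intro x hx y hy hxy
      obtain ⟨i, rfl⟩ := List.get_of_mem hx
      obtain ⟨j, rfl⟩ := List.get_of_mem hy
      rw [hg, hg]
      have := (hf i j).2 hxy
      rw [Fin.lt_def] at this
      omega
    · rw [List.sublist_iff_exists_fin_orderEmbedding_get_eq]
      refine ⟨((Fin.castOrderIso (List.length_map g)).toOrderEmbedding.trans f).trans
        (Fin.castOrderIso (by simp [oneLine])).toOrderEmbedding, fun i => ?_⟩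
      have := hg (Fin.cast (List.length_map g) i)
      simp only [oneLine, List.get_eq_getElem, List.getElem_map, List.getElem_ofFn]
      exact this
  · rintro ⟨g, hg, hs⟩
    rw [List.sublist_iff_exists_fin_orderEmbedding_get_eq] at hs
    obtain ⟨f, hf⟩ := hs
    refine ⟨((Fin.castOrderIso (List.length_map g).symm).toOrderEmbedding.trans f).trans
        (Fin.castOrderIso (by simp [oneLine])).toOrderEmbedding, fun i j => ?_⟩
    have hi := hf (Fin.cast (List.length_map g).symm i)
    have hj := hf (Fin.cast (List.length_map g).symm j)
    simp only [oneLine, List.get_eq_getElem, List.getElem_map, List.getElem_ofFn] at hi hj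
    rw [← hg.lt_iff_lt (List.get_mem w i) (List.get_mem w j), Fin.lt_def]
    simp only [List.get_eq_getElem]
    simp only [Fin.val_cast] at hi hj
    rw [hi, hj]
    simp only [add_lt_add_iff_right]
    rfl

/-! ### Binary trees and `132`-avoiding permutations -/

/-- The `132`-avoiding permutation encoded by a binary tree: the subtrees of the root describe the
letters to the left and to the right of the largest letter. -/
def word : BinaryTree Unit → List ℕ
  | .nil => []
  | .node _ a b => (word a).map (· + b.numNodes) ++ (a.numNodes + b.numNodes + 1) :: word b

theorem map_add_range' (c s n : ℕ) :
    (List.range' s n).map (· + c) = List.range' (s + c) n := by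
  simp_rw [add_comm _ c]
  exact List.map_add_range' ..

theorem word_perm (t : BinaryTree Unit) : (word t).Perm (List.range' 1 t.numNodes) := by
  induction t with
  | nil => simp [word]
  | node _ a b iha ihb =>
    have h1 := iha.map (· + b.numNodes)
    rw [map_add_range'] at h1
    have e : List.range' 1 (a.numNodes + b.numNodes + 1) =
        List.range' 1 b.numNodes ++ List.range' (1 + b.numNodes) a.numNodes ++
          [a.numNodes + b.numNodes + 1] := by
      rw [List.range'_append_1, add_comm b.numNodes, List.range'_1_concat, add_comm 1]
    rw [word, BinaryTree.numNodes, e]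
    refine List.perm_middle.trans (List.Perm.trans ?_ (List.perm_append_singleton _ _).symm)
    exact ((h1.append ihb).trans List.perm_append_comm).cons _

theorem mem_word {t : BinaryTree Unit} {x : ℕ} : x ∈ word t ↔ 1 ≤ x ∧ x ≤ t.numNodes := by
  rw [(word_perm t).mem_iff, List.mem_range'_1]
  omega

theorem length_word (t : BinaryTree Unit) : (word t).length = t.numNodes := by
  simpa using (word_perm t).length_eq

theorem word_injective : Function.Injective word := by
  intro t
  induction t with
  | nil =>
    intro s h
    cases s with
    | nil => rfl
    | node => simp [word] at h
  | node _ a b iha ihb =>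
    intro s h
    cases s with
    | nil => simp [word] at h
    | node _ a' b' =>
      have hlen := congrArg List.length h
      rw [length_word, length_word, BinaryTree.numNodes, BinaryTree.numNodes] at hlen
      simp only [word] at h
      rw [hlen] at h
      -- The largest letter does not occur in the left part, so both words split at the same place.
      have n1 : ∀ (a b : BinaryTree Unit) (N : ℕ), a.numNodes + b.numNodes < N →
          N ∉ (word a).map (· + b.numNodes) := by
        intro a b N hN hm
        obtain ⟨x, hx, hx'⟩ := List.mem_map.1 hm
        rw [mem_word] at hx
        omega
      obtain ⟨h1, h2⟩ : (word a).map (· + b.numNodes) = (word a').map (· + b'.numNodes) ∧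
          word b = word b' := by
        rcases List.append_eq_append_iff.1 h with ⟨c, hc, hc'⟩ | ⟨c, hc, hc'⟩ <;>
        cases c with
        | nil => simp_all
        | cons d c =>
          simp only [List.cons_append, List.cons.injEq] at hc'
          rw [← hc'.1] at hc
          have hm := congrArg (a'.numNodes + b'.numNodes + 1 ∈ ·) hc
          simp only [List.mem_append, List.mem_cons, true_or, or_true, eq_iff_iff, iff_true] at hm
          exact absurd hm (n1 _ _ _ (by omega))
      have hb := ihb h2
      subst hb
      have ha := iha (List.map_injective_iff.2 (add_left_injective _) h1)
      subst ha
      rfl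

theorem occurs_132_iff (L : List ℕ) :
    Occurs L [1, 3, 2] ↔ ∃ x y z, x < y ∧ y < z ∧ [x, z, y].Sublist L := by
  constructor
  · rintro ⟨g, hg, hs⟩
    exact ⟨g 1, g 2, g 3, hg (by simp) (by simp) (by simp), hg (by simp) (by simp) (by simp), hs⟩
  · rintro ⟨x, y, z, hxy, hyz, hs⟩
    refine ⟨fun i => if i = 1 then x else if i = 2 then y else z, ?_, by simpa using hs⟩
    intro i hi j hj hij
    simp only [Set.mem_ofPred_eq, List.mem_cons, List.not_mem_nil, or_false] at hi hj
    rcases hi with rfl | rfl | rfl <;> rcases hj with rfl | rfl | rfl <;> simp at hij ⊢ <;> omega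

theorem word_avoids (t : BinaryTree Unit) : ¬ Occurs (word t) [1, 3, 2] := by
  induction t with
  | nil => exact not_occurs_nil (by simp)
  | node _ a b iha ihb =>
    rw [← occurs_map_left_iff (add_left_strictMono (a := b.numNodes)), occurs_132_iff] at iha
    rw [occurs_132_iff] at ihb
    rw [occurs_132_iff, word]
    rintro ⟨x, y, z, hxy, hyz, hs⟩
    have hA : ∀ x ∈ (word a).map (· + b.numNodes), b.numNodes < x ∧
        x < a.numNodes + b.numNodes + 1 := by
      intro x hx
      obtain ⟨v, hv, rfl⟩ := List.mem_map.1 hx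
      rw [mem_word] at hv
      omega
    have hB : ∀ x ∈ word b, x ≤ b.numNodes := fun x hx => (mem_word.1 hx).2
    obtain ⟨p, s, e, hp, hs⟩ := List.sublist_append_iff.1 hs
    match p, e with
    | [], e =>
      rw [List.nil_append] at e
      subst e
      rcases List.sublist_cons_iff.1 hs with hs | ⟨r, hr, hs⟩
      · exact ihb ⟨x, y, z, hxy, hyz, hs⟩
      · simp only [List.cons.injEq] at hr
        have := hB z (hs.subset (by simp [← hr.2]))
        omega
    | [u], e =>
      simp only [List.cons_append, List.nil_append, List.cons.injEq] at e
      obtain ⟨rfl, rfl⟩ := e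
      have h1 := hA x (hp.subset (by simp))
      rcases List.sublist_cons_iff.1 hs with hs | ⟨r, hr, hs⟩
      · have := hB y (hs.subset (by simp))
        omega
      · simp only [List.cons.injEq] at hr
        have := hB y (hs.subset (by simp [← hr.2]))
        omega
    | [u, v], e =>
      simp only [List.cons_append, List.nil_append, List.cons.injEq] at e
      obtain ⟨rfl, rfl, rfl⟩ := e
      have h1 := hA x (hp.subset (by simp))
      have h2 := hA z (hp.subset (by simp))
      have := hs.subset (show y ∈ [y] by simp)
      rcases List.mem_cons.1 this with h | h
      · omega
      · have := hB y h
        omega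
    | u :: v :: w :: p, e =>
      simp only [List.cons_append, List.cons.injEq] at e
      obtain ⟨rfl, rfl, rfl, e⟩ := e
      have := List.append_eq_nil_iff.1 e.symm
      rw [this.1] at hp
      exact iha ⟨x, y, z, hxy, hyz, hp⟩

/-- If all letters of `L₁` exceed those of `L₂` and together they are `s, s + 1, …`, then each of
the two words is a rearrangement of an interval. -/
theorem perm_range'_of_append {L₁ L₂ : List ℕ} {s n : ℕ}
    (h : (L₂ ++ L₁).Perm (List.range' s n)) (h12 : ∀ x ∈ L₁, ∀ y ∈ L₂, y < x) :
    L₂.Perm (List.range' s L₂.length) ∧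
      L₁.Perm (List.range' (s + L₂.length) L₁.length) := by
  have hn : n = L₂.length + L₁.length := by simpa using h.length_eq.symm
  -- Sorting each word and concatenating yields a sorted word, which must be the interval itself.
  have p₁ := L₁.mergeSort_perm (fun a b => decide (a ≤ b))
  have p₂ := L₂.mergeSort_perm (fun a b => decide (a ≤ b))
  have s₁ := List.pairwise_mergeSort' (· ≤ ·) L₁
  have s₂ := List.pairwise_mergeSort' (· ≤ ·) L₂
  have hs : (L₂.mergeSort (fun a b => decide (a ≤ b)) ++
      L₁.mergeSort (fun a b => decide (a ≤ b))).Pairwise (· ≤ ·) := by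
    refine List.pairwise_append.2 ⟨s₂, s₁, fun a ha b hb => ?_⟩
    exact (h12 b (p₁.subset hb) a (p₂.subset ha)).le
  have e := ((p₂.append p₁).trans h).eq_of_pairwise' hs
    (List.pairwise_le_range' ..)
  rw [hn, ← List.range'_append_1] at e
  obtain ⟨e₂, e₁⟩ := List.append_inj e (by simp)
  exact ⟨e₂ ▸ p₂.symm, e₁ ▸ p₁.symm⟩

theorem exists_word {n : ℕ} {L : List ℕ} (hL : L.Perm (List.range' 1 n))
    (h : ¬ Occurs L [1, 3, 2]) : ∃ t : BinaryTree Unit, t.numNodes = n ∧ word t = L := by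
  induction n using Nat.strong_induction_on generalizing L with
  | _ n ih =>
    cases n with
    | zero =>
      refine ⟨.nil, rfl, ?_⟩
      simp at hL
      simp [hL, word]
    | succ n =>
      have hmem : n + 1 ∈ L := by rw [hL.mem_iff, List.mem_range'_1]; omega
      obtain ⟨L₁, L₂, rfl⟩ := List.append_of_mem hmem
      have hnd := (hL.nodup_iff).2 List.nodup_range'
      have hle : ∀ x ∈ L₁ ++ (n + 1) :: L₂, 1 ≤ x ∧ x ≤ n + 1 := by
        intro x hx
        rw [hL.mem_iff, List.mem_range'_1] at hx
        omega
      have hperm : (L₂ ++ L₁).Perm (List.range' 1 n) := by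
        have h1 := List.perm_middle.symm.trans hL
        rw [List.range'_1_concat, add_comm 1] at h1
        exact List.perm_append_comm.trans
          ((List.perm_cons _).1 (h1.trans (List.perm_append_singleton _ _)))
      -- Otherwise `x`, `n + 1`, `y` would form a `132`.
      have h12 : ∀ x ∈ L₁, ∀ y ∈ L₂, y < x := by
        intro x hx y hy
        by_contra hxy
        have h1 := List.nodup_append.1 hnd
        have h2 : x ≠ y := h1.2.2 x hx y (by simp [hy])
        have h3 : y ≠ n + 1 := by
          rintro rfl
          exact (List.nodup_cons.1 h1.2.1).1 hy
        have h4 := hle y (by simp [hy])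
        refine h ((occurs_132_iff _).2 ⟨x, y, n + 1, by omega, by omega, ?_⟩)
        exact (List.singleton_sublist.2 hx).append ((List.singleton_sublist.2 hy).cons_cons _)
      have hlen : L₂.length + L₁.length = n := by simpa using hperm.length_eq
      obtain ⟨q₂, q₁⟩ := perm_range'_of_append hperm h12
      have e₁ : (L₁.map (· - L₂.length)).map (· + L₂.length) = L₁ := by
        rw [List.map_map]
        conv_rhs => rw [← List.map_id L₁]
        refine List.map_congr_left fun x hx => ?_
        have := q₁.mem_iff.1 hx
        rw [List.mem_range'_1] at this
        simp only [Function.comp, id]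
        omega
      have q₁' : (L₁.map (· - L₂.length)).Perm (List.range' 1 L₁.length) := by
        have := q₁.map (· - L₂.length)
        rwa [← map_add_range', List.map_map,
          show (fun x => x - L₂.length) ∘ (fun x => x + L₂.length) = id by ext; simp,
          List.map_id] at this
      have a₁ : ¬ Occurs (L₁.map (· - L₂.length)) [1, 3, 2] := by
        rw [← occurs_map_left_iff (add_left_strictMono (a := L₂.length)), e₁]
        exact fun h' => h (h'.mono (List.sublist_append_left _ _))
      obtain ⟨t₁, ht₁, w₁⟩ := ih L₁.length (by omega) q₁' a₁
      obtain ⟨t₂, ht₂, w₂⟩ := ih L₂.length (by omega) q₂ fun h' =>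
        h (h'.mono ((List.sublist_cons_self _ _).trans (List.sublist_append_right _ _)))
      refine ⟨.node () t₁ t₂, ?_, ?_⟩
      · simp only [BinaryTree.numNodes]; omega
      · rw [word, w₁, w₂, ht₁, ht₂, e₁, add_comm L₁.length, hlen]

theorem exists_oneLine_iff {n : ℕ} {L : List ℕ} :
    (∃ α : Equiv.Perm (Fin n), oneLine α = L) ↔ L.Perm (List.range' 1 n) := by
  have hr : ∀ α : Equiv.Perm (Fin n), (oneLine α).Perm (List.range' 1 n) := by
    intro α
    refine (List.perm_ext_iff_of_nodup ?_ List.nodup_range').2 fun x => ?_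
    · refine List.nodup_ofFn.2 fun i j h => ?_
      apply α.injective
      ext
      simpa using h
    · rw [oneLine, List.mem_ofFn, List.mem_range'_1]
      constructor
      · rintro ⟨i, rfl⟩
        omega
      · intro hx
        exact ⟨α.symm ⟨x - 1, by omega⟩, by simp; omega⟩
  constructor
  · rintro ⟨α, rfl⟩
    exact hr α
  · intro h
    have hlen : L.length = n := by simpa using h.length_eq
    subst hlen
    have hnd := h.nodup_iff.2 List.nodup_range'
    have hm : ∀ i : Fin L.length, 1 ≤ L.get i ∧ L.get i < 1 + L.length := fun i =>
      List.mem_range'_1.1 (h.mem_iff.1 (List.get_mem L i))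
    let f : Fin L.length → Fin L.length := fun i => ⟨L.get i - 1, by have := hm i; omega⟩
    have hf : Function.Injective f := by
      intro i j hij
      have h1 := hm i
      have h2 := hm j
      simp only [f, Fin.mk.injEq] at hij
      exact List.nodup_iff_injective_get.1 hnd (by omega)
    refine ⟨Equiv.ofBijective f (Finite.injective_iff_bijective.1 hf), ?_⟩
    conv_rhs => rw [← List.ofFn_get L]
    rw [oneLine]
    congr 1
    ext i
    have := hm i
    simp only [Equiv.ofBijective_apply, f]
    omega

theorem oneLine_injective {n : ℕ} : Function.Injective (oneLine (n := n)) := by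
  intro α β h
  ext i
  have := congrFun (List.ofFn_injective h) i
  simpa using this

open Classical in
theorem ncard_avoiders (n : ℕ) (w : List ℕ) :
    (avoiders n w).ncard =
      ((BinaryTree.treesOfNumNodesEq n).filter fun t => ¬ Occurs (word t) w).card := by
  rw [← Set.ncard_coe_finset, ← Set.ncard_image_of_injective _ oneLine_injective,
    ← Set.ncard_image_of_injective _ word_injective]
  congr 1
  ext L
  simp only [Set.mem_image, avoiders, Set.mem_ofPred_eq, Finset.coe_filter,
    BinaryTree.mem_treesOfNumNodesEq, contains_iff_occurs]
  constructor
  · rintro ⟨α, ⟨h1, h2⟩, rfl⟩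
    obtain ⟨t, ht, e⟩ := exists_word (exists_oneLine_iff.1 ⟨α, rfl⟩) h1
    exact ⟨t, ⟨ht, e ▸ h2⟩, e⟩
  · rintro ⟨t, ⟨rfl, h⟩, rfl⟩
    obtain ⟨α, e⟩ := exists_oneLine_iff.2 (word_perm t)
    exact ⟨α, ⟨e ▸ word_avoids t, e ▸ h⟩, e⟩

/-! ### Recursion for the generating function -/

open PowerSeries

theorem sum_trees_succ (n : ℕ) (f : BinaryTree Unit → ℚ) :
    ∑ t ∈ BinaryTree.treesOfNumNodesEq (n + 1), f t =
      ∑ p ∈ Finset.HasAntidiagonal.antidiagonal n, ∑ a ∈ BinaryTree.treesOfNumNodesEq p.1,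
        ∑ b ∈ BinaryTree.treesOfNumNodesEq p.2, f (.node () a b) := by
  rw [BinaryTree.treesOfNumNodesEq_succ, Finset.sum_biUnion]
  · refine Finset.sum_congr rfl fun p _ => ?_
    rw [Finset.sum_map, Finset.sum_product]
    rfl
  · intro p _ p' _ hp
    rw [Function.onFun, Finset.disjoint_left]
    intro t ht ht'
    simp only [Finset.mem_map, Finset.mem_product, BinaryTree.mem_treesOfNumNodesEq] at ht ht'
    obtain ⟨⟨a, b⟩, ⟨h1, h2⟩, rfl⟩ := ht
    obtain ⟨⟨a', b'⟩, ⟨h1', h2'⟩, h⟩ := ht'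
    replace h : BinaryTree.node () a' b' = .node () a b := h
    simp only [BinaryTree.node.injEq, true_and] at h
    obtain ⟨rfl, rfl⟩ := h
    exact hp (Prod.ext (h1.symm.trans h1') (h2.symm.trans h2'))

open Classical in
/-- The indicator of the trees whose permutation avoids `w`. -/
noncomputable def avoidInd (w : List ℕ) (t : BinaryTree Unit) : ℚ :=
  if Occurs (word t) w then 0 else 1

theorem coeff_genFun (w : List ℕ) (n : ℕ) :
    coeff n (genFun w) = ∑ t ∈ BinaryTree.treesOfNumNodesEq n, avoidInd w t := by
  classical
  simp only [genFun, coeff_mk, ncard_avoiders, avoidInd, Finset.card_filter]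
  push_cast
  refine Finset.sum_congr rfl fun t _ => ?_
  by_cases h : Occurs (word t) w <;> simp [h]

theorem coeff_genFun_mul (v w : List ℕ) (n : ℕ) :
    coeff n (genFun v * genFun w) =
      ∑ p ∈ Finset.HasAntidiagonal.antidiagonal n, ∑ a ∈ BinaryTree.treesOfNumNodesEq p.1,
        ∑ b ∈ BinaryTree.treesOfNumNodesEq p.2, avoidInd v a * avoidInd w b := by
  simp only [coeff_mul, coeff_genFun, Finset.sum_mul_sum]

theorem occurs_word_node {a b : BinaryTree Unit} {w z : List ℕ} {M : ℕ}
    (hwz : ∀ x ∈ w, ∀ y ∈ z, y < x) (hwM : ∀ x ∈ w, x < M) (hzM : ∀ y ∈ z, y < M)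
    (hz : z = [] ∨ ∃ z' c, z = z' ++ [c] ∧ ∀ x ∈ z', x < c) :
    Occurs (word (.node () a b)) (w ++ M :: z) ↔ Occurs (word b) (w ++ M :: z) ∨
      Occurs (word a) (w ++ M :: z) ∨ (Occurs (word a) w ∧ Occurs (word b) z) := by
  have hA : ∀ x ∈ (word a).map (· + b.numNodes), b.numNodes < x ∧
      x < a.numNodes + b.numNodes + 1 := by
    intro x hx
    obtain ⟨v, hv, rfl⟩ := List.mem_map.1 hx
    rw [mem_word] at hv
    omega
  have hB : ∀ x ∈ word b, x ≤ b.numNodes := fun x hx => (mem_word.1 hx).2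
  rw [word, occurs_append_cons_iff (fun x hx y hy => (hB y hy).trans_lt (hA x hx).1)
    (fun x hx => (hA x hx).2) (fun y hy => by have := hB y hy; omega) hwz hwM hzM hz,
    occurs_map_left_iff add_left_strictMono, occurs_map_left_iff add_left_strictMono]

/-- The recursion for the generating function of a pattern `(w, M, z)`, where `M` is the largest
letter and the letters of `z` are below those of `w`. -/
theorem genFun_append_cons {w z : List ℕ} {M : ℕ}
    (hwz : ∀ x ∈ w, ∀ y ∈ z, y < x) (hwM : ∀ x ∈ w, x < M) (hzM : ∀ y ∈ z, y < M)
    (hz : z = [] ∨ ∃ z' c, z = z' ++ [c] ∧ ∀ x ∈ z', x < c) :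
    genFun (w ++ M :: z) = 1 + X * (genFun w * genFun (w ++ M :: z) +
      genFun (w ++ M :: z) * genFun z - genFun w * genFun z) := by
  ext n
  cases n with
  | zero =>
    have : ¬ Occurs [] (w ++ M :: z) := not_occurs_nil (by simp)
    simp [coeff_genFun, avoidInd, word, this]
  | succ n =>
    rw [map_add, coeff_succ_X_mul, map_sub, map_add, coeff_genFun_mul, coeff_genFun_mul,
      coeff_genFun_mul, coeff_genFun, sum_trees_succ, coeff_one, if_neg n.succ_ne_zero, zero_add]
    simp only [← Finset.sum_add_distrib, ← Finset.sum_sub_distrib]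
    refine Finset.sum_congr rfl fun p _ => Finset.sum_congr rfl fun a _ =>
      Finset.sum_congr rfl fun b _ => ?_
    have h1 : Occurs (word a) (w ++ M :: z) → Occurs (word a) w :=
      fun h => h.of_sublist (List.sublist_append_left _ _)
    have h2 : Occurs (word b) (w ++ M :: z) → Occurs (word b) z :=
      fun h => h.of_sublist ((List.sublist_cons_self _ _).trans (List.sublist_append_right _ _))
    have hnode := occurs_word_node (a := a) (b := b) hwz hwM hzM hz
    simp only [avoidInd]
    -- Inclusion-exclusion: the node avoids the pattern iff `a` avoids `w` and `b` the pattern, or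
    -- `a` the pattern and `b` avoids `z`; both hold exactly when `a` avoids `w` and `b` avoids `z`.
    by_cases h3 : Occurs (word a) (w ++ M :: z) <;> by_cases h4 : Occurs (word b) (w ++ M :: z) <;>
      by_cases h5 : Occurs (word a) w <;> by_cases h6 : Occurs (word b) z <;>
      simp_all

/-! ### Chebyshev polynomials and closure of `HasChebGenFun` -/

/-- The polynomials in `x = y ^ 2` with `y * chebSeq k = y ^ k * U_{k - 1}(1 / (2 y))`. -/
noncomputable def chebSeq : ℕ → PowerSeries ℚ
  | 0 => 0
  | 1 => 1
  | k + 2 => chebSeq (k + 1) - X * chebSeq k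

/-- The addition formula for Chebyshev polynomials, in the form matching the length `a + b + 1` of
`(w, M, z)`. -/
theorem chebSeq_add (a b : ℕ) :
    chebSeq (a + b + 1) = chebSeq (a + 1) * chebSeq (b + 1) - X * chebSeq a * chebSeq b := by
  induction a generalizing b with
  | zero => simp [chebSeq]
  | succ a ih =>
    rw [show a + 1 + b + 1 = a + (b + 1) + 1 by ring, ih]
    simp only [chebSeq]
    ring

theorem constantCoeff_chebSeq (k : ℕ) : constantCoeff (chebSeq (k + 1)) = 1 := by
  induction k with
  | zero => simp [chebSeq]
  | succ k ih => simp [chebSeq, ih]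

/-- The generating function of `w` is `R_k` for `k` the length of `w`, in division-free form. -/
def HasChebGenFun (w : List ℕ) : Prop :=
  genFun w * chebSeq (w.length + 1) = chebSeq w.length

theorem HasChebGenFun.append_cons {w z : List ℕ} {M : ℕ} (hw : HasChebGenFun w)
    (hz : HasChebGenFun z) (hwz : ∀ x ∈ w, ∀ y ∈ z, y < x) (hwM : ∀ x ∈ w, x < M)
    (hzM : ∀ y ∈ z, y < M) (hz' : z = [] ∨ ∃ z' c, z = z' ++ [c] ∧ ∀ x ∈ z', x < c) :
    HasChebGenFun (w ++ M :: z) := by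
  have h := genFun_append_cons hwz hwM hzM hz'
  unfold HasChebGenFun at *
  have e1 := chebSeq_add w.length z.length
  have e2 := chebSeq_add (w.length + 1) z.length
  have e3 : chebSeq (w.length + 1 + 1) = chebSeq (w.length + 1) - X * chebSeq w.length := rfl
  rw [List.length_append, List.length_cons,
    show w.length + (z.length + 1) + 1 = w.length + 1 + z.length + 1 by ring,
    show w.length + (z.length + 1) = w.length + z.length + 1 by ring, e2, e1, e3]
  generalize genFun (w ++ M :: z) = F at *
  generalize genFun w = A at *
  generalize genFun z = B at *
  generalize chebSeq w.length = a at *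
  generalize chebSeq (w.length + 1) = a' at *
  generalize chebSeq z.length = b at *
  generalize chebSeq (z.length + 1) = b' at *
  rw [← hw, ← hz]
  -- The recursion reads `F (1 - xA - xB) = 1 - xAB`; multiplying by `a' b'` clears the denominators
  -- of `A = a / a'` and `B = b / b'`.
  linear_combination (a' * b') * h

/-- Every permutation contains the empty word; this matches `R_0 = 0` and starts the induction. -/
theorem genFun_nil : genFun ([] : List ℕ) = 0 := by
  ext n
  simp [coeff_genFun, avoidInd, occurs_nil]

theorem hasChebGenFun_nil : HasChebGenFun [] := by
  rw [HasChebGenFun, genFun_nil]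
  simp [chebSeq]

theorem HasChebGenFun.append_singleton {w : List ℕ} {M : ℕ} (hw : HasChebGenFun w)
    (hM : ∀ x ∈ w, x < M) : HasChebGenFun (w ++ [M]) :=
  hw.append_cons hasChebGenFun_nil (by simp) hM (by simp) (Or.inl rfl)

theorem HasChebGenFun.append_of_pairwise {w t : List ℕ} (hw : HasChebGenFun w)
    (ht : t.Pairwise (· < ·)) (hwt : ∀ x ∈ w, ∀ y ∈ t, x < y) : HasChebGenFun (w ++ t) := by
  induction t using List.reverseRecOn with
  | nil => simpa
  | append_singleton t M ih =>
    rw [List.pairwise_append] at ht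
    rw [← List.append_assoc]
    refine (ih ht.1 fun x hx y hy => hwt x hx y (by simp [hy])).append_singleton fun x hx => ?_
    rcases List.mem_append.1 hx with h | h
    · exact hwt x h M (by simp)
    · exact ht.2.2 x h M (by simp)

theorem HasChebGenFun.map {w : List ℕ} (hw : HasChebGenFun w) {h : ℕ → ℕ} (hh : StrictMono h) :
    HasChebGenFun (w.map h) := by
  have : genFun (w.map h) = genFun w := by
    ext n
    have : avoidInd (w.map h) = avoidInd w := by
      funext t
      classical
      exact if_congr (occurs_map_right_iff hh _ _) rfl rfl
    simp only [coeff_genFun, this]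
  rwa [HasChebGenFun, this, List.length_map]

theorem HasChebGenFun.equalsR {w : List ℕ} (hw : HasChebGenFun w) :
    EqualsR (genFun w) w.length := by
  set y : LaurentSeries ℚ := ((X : PowerSeries ℚ) : LaurentSeries ℚ) with hy
  let φ : PowerSeries ℚ →+* LaurentSeries ℚ :=
    (HahnSeries.ofPowerSeries ℤ ℚ).comp (expand 2 two_ne_zero : PowerSeries ℚ →ₐ[ℚ] _).toRingHom
  have hφ : ∀ F, φ F = ((expand 2 two_ne_zero F : PowerSeries ℚ) : LaurentSeries ℚ) :=
    fun _ => rfl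
  have hy0 : y ≠ 0 := by
    rw [hy, Ne, map_eq_zero_iff _ HahnSeries.ofPowerSeries_injective]
    exact X_ne_zero
  have := algebraRat.charZero (LaurentSeries ℚ)
  have htwo : (2 : LaurentSeries ℚ) ≠ 0 := two_ne_zero
  have hX : φ X = y ^ 2 := by
    rw [hφ, expand_X, hy, map_pow]
  -- At `k = 0` both sides vanish, since `U_{-1} = 0`.
  have hU : ∀ k : ℕ, y * φ (chebSeq k) =
      y ^ k * (Polynomial.Chebyshev.U (LaurentSeries ℚ) ((k : ℤ) - 1)).eval (1 / (2 * y)) := by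
    intro k
    induction k using Nat.twoStepInduction with
    | zero => simp [chebSeq]
    | one => simp [chebSeq]
    | more k h0 h1 =>
      rw [show ((k + 2 : ℕ) : ℤ) - 1 = ((k : ℤ) - 1) + 2 by push_cast; ring,
        Polynomial.Chebyshev.U_add_two, chebSeq, map_sub, map_mul, hX]
      rw [show ((k + 1 : ℕ) : ℤ) - 1 = ((k : ℤ) - 1) + 1 by push_cast; ring] at h1
      simp only [Polynomial.eval_sub, Polynomial.eval_mul, Polynomial.eval_ofNat,
        Polynomial.eval_X]
      have e : 2 * (1 / (2 * y)) * y = 1 := by field_simp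
      linear_combination h1 - y ^ 2 * h0 - y ^ (k + 1) * e *
        (Polynomial.Chebyshev.U (LaurentSeries ℚ) ((k : ℤ) - 1 + 1)).eval (1 / (2 * y))
  -- The constant coefficient of `chebSeq (w.length + 1)` is `1`.
  have hne : φ (chebSeq (w.length + 1)) ≠ 0 := by
    rw [hφ, Ne, map_eq_zero_iff _ HahnSeries.ofPowerSeries_injective]
    intro h
    have := congrArg constantCoeff h
    rw [constantCoeff_expand, constantCoeff_chebSeq] at this
    simp at this
  have h0 := hU w.length
  have h1 := hU (w.length + 1)
  rw [show ((w.length + 1 : ℕ) : ℤ) - 1 = w.length by push_cast; ring] at h1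
  have h2 := congrArg φ hw
  rw [map_mul] at h2
  rw [EqualsR, ← hφ, chebR, ← hy]
  have hU1 : (Polynomial.Chebyshev.U (LaurentSeries ℚ) (w.length : ℤ)).eval (1 / (2 * y)) ≠ 0 := by
    intro h
    rw [h, mul_zero] at h1
    exact (mul_ne_zero hy0 hne) h1
  rw [eq_div_iff hU1]
  have e : 2 * (1 / (2 * y)) = 1 / y := by field_simp
  rw [e, div_mul_eq_mul_div, one_mul, eq_div_iff hy0]
  apply mul_left_cancel₀ (pow_ne_zero w.length hy0)
  linear_combination (-φ (genFun w)) * h1 + y * h2 + h0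

/-! ### Invariance under inversion -/

theorem contains_oneLine_iff {m n : ℕ} (α : Equiv.Perm (Fin n)) (σ : Equiv.Perm (Fin m)) :
    Contains α (oneLine σ) ↔ ∃ f : Fin m ↪o Fin n, ∀ i j, α (f i) < α (f j) ↔ σ i < σ j := by
  have hlen : (oneLine σ).length = m := by simp [oneLine]
  have key : ∀ i, (oneLine σ).get i = (σ (Fin.cast hlen i) : ℕ) + 1 := fun i =>
    List.get_ofFn (fun i => (σ i : ℕ) + 1) i
  constructor
  · rintro ⟨f, hf⟩
    refine ⟨(Fin.castOrderIso hlen.symm).toOrderEmbedding.trans f, fun i j => ?_⟩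
    refine (hf _ _).trans ?_
    rw [key, key, add_lt_add_iff_right, ← Fin.lt_def]
    rfl
  · rintro ⟨f, hf⟩
    refine ⟨(Fin.castOrderIso hlen).toOrderEmbedding.trans f, fun i j => ?_⟩
    rw [key, key, add_lt_add_iff_right, ← Fin.lt_def]
    exact hf _ _

theorem Contains.inv {m n : ℕ} {α : Equiv.Perm (Fin n)} {σ : Equiv.Perm (Fin m)}
    (h : Contains α (oneLine σ)) : Contains α⁻¹ (oneLine σ⁻¹) := by
  rw [contains_oneLine_iff] at h ⊢
  obtain ⟨f, hf⟩ := h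
  -- Inversion exchanges positions and values: the values of the old occurrence, sorted, are the
  -- positions of the new one.
  refine ⟨OrderEmbedding.ofStrictMono (fun i => α (f (σ⁻¹ i))) fun i j hij => ?_, fun i j => ?_⟩
  · rw [hf]
    simpa using hij
  · simp

theorem contains_inv_iff {m n : ℕ} {α : Equiv.Perm (Fin n)} {σ : Equiv.Perm (Fin m)} :
    Contains α⁻¹ (oneLine σ⁻¹) ↔ Contains α (oneLine σ) :=
  ⟨fun h => by simpa using h.inv, Contains.inv⟩

theorem genFun_oneLine_inv {m : ℕ} (σ : Equiv.Perm (Fin m)) :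
    genFun (oneLine σ⁻¹) = genFun (oneLine σ) := by
  ext n
  simp only [genFun, coeff_mk, Nat.cast_inj]
  have h132 : [1, 3, 2] = oneLine (Equiv.swap (1 : Fin 3) 2) := by decide
  rw [← Set.ncard_image_of_injective (avoiders n (oneLine σ)) inv_injective]
  congr 1
  ext α
  simp only [Set.mem_image, avoiders, Set.mem_ofPred_eq]
  have h : ∀ β : Equiv.Perm (Fin n), Contains β⁻¹ [1, 3, 2] ↔ Contains β [1, 3, 2] := by
    intro β
    rw [h132]
    conv_lhs => rw [← Equiv.swap_inv]
    exact contains_inv_iff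
  constructor
  · rintro ⟨h1, h2⟩
    refine ⟨α⁻¹, ⟨by rwa [h], ?_⟩, inv_inv α⟩
    rwa [← contains_inv_iff, inv_inv]
  · rintro ⟨β, ⟨h1, h2⟩, rfl⟩
    exact ⟨by rwa [h], by rwa [contains_inv_iff]⟩

theorem HasChebGenFun.oneLine_inv {m : ℕ} {σ : Equiv.Perm (Fin m)}
    (h : HasChebGenFun (oneLine σ)) : HasChebGenFun (oneLine σ⁻¹) := by
  unfold HasChebGenFun at *
  rw [genFun_oneLine_inv]
  simpa [oneLine] using h

/-! ### Wedge patterns and the extended patterns -/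

/-- Only the order relations among blocks matter, and they pass to the first `r` blocks, whose
letters need not form an interval; hence this form for the induction. -/
theorem hasChebGenFun_of_blocks (r : ℕ) (τ ρ : Fin r → List ℕ) (hτ : ∀ i, τ i ≠ [])
    (hτs : (List.ofFn τ).flatten.Pairwise (· < ·)) (hρ : ∀ i, (ρ i).Pairwise (· < ·))
    (hρτ : ∀ i j, ∀ x ∈ ρ i, ∀ y ∈ τ j, x < y)
    (hρρ : ∀ i j, i < j → ∀ x ∈ ρ i, ∀ y ∈ ρ j, y < x) :
    HasChebGenFun (List.ofFn fun i => τ i ++ ρ i).flatten := by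
  induction r with
  | zero => simpa using hasChebGenFun_nil
  | succ r ih =>
    rw [List.ofFn_succ', List.concat_eq_append, List.flatten_append] at hτs ⊢
    simp only [List.flatten_singleton, List.pairwise_append] at hτs ⊢
    obtain ⟨hτ₁, hτ₂, hτ₃⟩ := hτs
    have hW := ih (fun i => τ i.castSucc) (fun i => ρ i.castSucc) (fun i => hτ _) hτ₁
      (fun i => hρ _) (fun i j => hρτ _ _)
      (fun i j hij => hρρ _ _ (Fin.castSucc_lt_castSucc_iff.2 hij))
    set W := (List.ofFn fun i : Fin r => τ i.castSucc ++ ρ i.castSucc).flatten with hWdef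
    have memW : ∀ x ∈ W, (∃ i : Fin r, x ∈ τ i.castSucc) ∨ ∃ i : Fin r, x ∈ ρ i.castSucc := by
      intro x hx
      simp only [hWdef, List.mem_flatten, List.mem_ofFn] at hx
      obtain ⟨_, ⟨i, rfl⟩, hx⟩ := hx
      rcases List.mem_append.1 hx with h | h
      · exact Or.inl ⟨i, h⟩
      · exact Or.inr ⟨i, h⟩
    have hWτ : ∀ x ∈ W, ∀ y ∈ τ (Fin.last r), x < y := by
      intro x hx y hy
      rcases memW x hx with ⟨i, hi⟩ | ⟨i, hi⟩
      · exact hτ₃ x (List.mem_flatten.2 ⟨_, List.mem_ofFn.2 ⟨i, rfl⟩, hi⟩) y hy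
      · exact hρτ _ _ x hi y hy
    have hWρ : ∀ x ∈ W, ∀ y ∈ ρ (Fin.last r), y < x := by
      intro x hx y hy
      rcases memW x hx with ⟨i, hi⟩ | ⟨i, hi⟩
      · exact hρτ _ _ y hy x hi
      · exact hρρ _ _ (Fin.castSucc_lt_last i) x hi y hy
    have hlast := hρτ (Fin.last r) (Fin.last r)
    have hinc := hρ (Fin.last r)
    generalize ρ (Fin.last r) = z at hWρ hlast hinc ⊢
    have hz : HasChebGenFun z := by
      simpa using hasChebGenFun_nil.append_of_pairwise hinc (by simp)
    -- The last letter `M` of the last `τ` is the maximum of the whole word, and the last `ρ` lies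
    -- below everything before it, so `append_cons` applies at `M`.
    obtain hnil | ⟨t, M, ht⟩ := List.eq_nil_or_concat (τ (Fin.last r))
    · exact absurd hnil (hτ _)
    rw [List.concat_eq_append] at ht
    rw [ht] at hWτ hlast hτ₂ ⊢
    rw [List.pairwise_append] at hτ₂
    have ht := hW.append_of_pairwise hτ₂.1 fun x hx y hy => hWτ x hx y (by simp [hy])
    rw [show W ++ (t ++ [M] ++ z) = W ++ t ++ M :: z by simp]
    refine ht.append_cons hz ?_ ?_ (fun y hy => hlast y hy M (by simp)) ?_
    · intro x hx y hy
      rcases List.mem_append.1 hx with h | h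
      · exact hWρ x h y hy
      · exact hlast y hy x (by simp [h])
    · intro x hx
      rcases List.mem_append.1 hx with h | h
      · exact hWτ x h M (by simp)
      · exact hτ₂.2.2 x h M (by simp)
    · rcases List.eq_nil_or_concat z with h | ⟨z', c, h⟩
      · exact Or.inl h
      · rw [List.concat_eq_append] at h
        rw [h, List.pairwise_append] at hinc
        exact Or.inr ⟨z', c, h, fun x hx => hinc.2.2 x hx c (by simp)⟩

theorem IsWedge.hasChebGenFun {n : ℕ} {σ : Equiv.Perm (Fin n)} (hσ : IsWedge σ) :
    HasChebGenFun (oneLine σ) := by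
  obtain ⟨r, s, τ, ρ, hτ, ⟨m, hm, hm0, -, hρ⟩, hflat, hσ⟩ := hσ
  rw [hσ]
  refine hasChebGenFun_of_blocks r τ ρ hτ ?_ ?_ ?_ ?_
  · rw [hflat]
    exact List.pairwise_lt_range' ..
  · intro i
    rw [hρ]
    exact List.pairwise_lt_range' ..
  · intro i j x hx y hy
    have hy' : y ∈ (List.ofFn τ).flatten :=
      List.mem_flatten.2 ⟨_, List.mem_ofFn.2 ⟨j, rfl⟩, hy⟩
    rw [hflat, List.mem_range'_1] at hy'
    rw [hρ, List.mem_range'_1] at hx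
    have := hm (Nat.zero_le (i : ℕ))
    omega
  · intro i j hij x hx y hy
    rw [hρ, List.mem_range'_1] at hx hy
    have : m j ≤ m (i + 1) := hm hij
    omega

theorem equalsR_extPattern {l k : ℕ} (hl : 1 ≤ l) (hk : 2 * l ≤ k) {u v : Equiv.Perm (Fin (l - 1))}
    (hu : HasChebGenFun (oneLine u)) (hv : HasChebGenFun (oneLine v)) :
    EqualsR (genFun (extPattern l k u v)) k := by
  have mem : ∀ (w : Equiv.Perm (Fin (l - 1))), ∀ x ∈ oneLine w, 1 ≤ x ∧ x < l := by
    intro w x hx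
    obtain ⟨i, rfl⟩ := List.mem_ofFn.1 hx
    have := (w i).isLt
    omega
  have memu : ∀ x ∈ (oneLine u).map (· + l), l < x ∧ x < 2 * l := by
    intro x hx
    obtain ⟨y, hy, rfl⟩ := List.mem_map.1 hx
    have := mem u y hy
    omega
  have memv : ∀ x ∈ oneLine v ++ [l], x ≤ l := by
    intro x hx
    rcases List.mem_append.1 hx with h | h
    · exact (mem v x h).2.le
    · simp_all
  have h1 : HasChebGenFun (oneLine v ++ [l]) := hv.append_singleton fun x hx => (mem v x hx).2
  -- The letter `l` after `v` makes the right-hand word end in its maximum, whatever `v` is.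
  have h2 : HasChebGenFun ((oneLine u).map (· + l) ++ (2 * l) :: (oneLine v ++ [l])) := by
    refine (hu.map add_left_strictMono).append_cons h1 ?_ (fun x hx => (memu x hx).2) ?_
      (Or.inr ⟨_, _, rfl, fun x hx => (mem v x hx).2⟩)
    · exact fun x hx y hy => (memv y hy).trans_lt (memu x hx).1
    · intro y hy
      have := memv y hy
      omega
  have h3 := h2.append_of_pairwise (t := List.range' (2 * l + 1) (k - 2 * l))
    (List.pairwise_lt_range' ..) (by
      intro x hx y hy
      rw [List.mem_range'_1] at hy
      rcases List.mem_append.1 hx with h | h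
      · have := memu x h
        omega
      · rcases List.mem_cons.1 h with h | h
        · omega
        · have := memv x h
          omega)
  have h4 : extPattern l k u v = (oneLine u).map (· + l) ++ (2 * l) :: (oneLine v ++ [l]) ++
      List.range' (2 * l + 1) (k - 2 * l) := by
    simp [extPattern]
  have h5 : (extPattern l k u v).length = k := by
    simp [extPattern, oneLine]
    omega
  rw [← h4] at h3
  simpa only [h5] using h3.equalsR

end WedgePattern

theorem mainTheorem12 (l : ℕ) (hl : 1 ≤ l) (σ : Equiv.Perm (Fin (l - 1)))
    (hσ : WedgePattern.IsWedge σ) (k : ℕ) (hk : 2 * l ≤ k) :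
    WedgePattern.EqualsR (WedgePattern.genFun (WedgePattern.extPattern l k σ⁻¹ σ)) k ∧
    WedgePattern.EqualsR (WedgePattern.genFun (WedgePattern.extPattern l k σ σ⁻¹)) k ∧
    WedgePattern.EqualsR (WedgePattern.genFun (WedgePattern.extPattern l k σ σ)) k :=
  have h := hσ.hasChebGenFun
  ⟨WedgePattern.equalsR_extPattern hl hk h.oneLine_inv h,
    WedgePattern.equalsR_extPattern hl hk h h.oneLine_inv,
    WedgePattern.equalsR_extPattern hl hk h h⟩
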